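/- For $\alpha\in\mathbb C$ let $|\alpha\rangle=e^{-|\alpha|^2/2}\sum_{n\ge 0}\frac{\alpha^n}{\sqrt{n!}}|n\rangle$ be the coherent state in the Fock space $\mathcal H=\ell^2(\mathbb N)$, and for $\mathcal E>0$ consider the BPSK classical-quantum channel with the two output states $|\sqrt{\mathcal E}\rangle$, $|-\sqrt{\mathcal E}\rangle$. For $N\ge 1$ let $C_{N,\mathsf{BPSK}}$ be the supremum, over all $M\in\mathbb N$, all maps (inner codes) $c$ from $\{1,\dots,M\}$ to $\{\sqrt{\mathcal E},-\sqrt{\mathcal E}\}^N$, all projective measurements $(P_k)_{k=1}^M$ on $\mathcal H^{\otimes N}$ (mutually orthogonal projections with $\sum_k P_k=\mathbb 1$), and all probability distributions $(p_j)_{j=1}^M$, of the mutual information (in nats) between the input $j\sim p$ and the output $k$ of the discrete channel $$p^{(N)}_{k|j}=\big\|P_k\big(|c_1(j)\rangle\otimes\cdots\otimes|c_N(j)\rangle\big)\big\|^2 .$$ All logarithms are natural. Put $$R^*=\mathcal E\log\tfrac1{\mathcal E}\left(1-\sqrt{\frac{\log\left(N\mathcal E\log(N\mathcal E)\right)}{N\mathcal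 E}}\right)+\mathcal E,$$ $$\widetilde E(R)=-\log\left(\Big(\tfrac{1+e^{-2\mathcal E}}2\Big)^{1+s}+\Big(\tfrac{1-e^{-2\mathcal E}}2\Big)^{1+s}\right)-sR,\qquad s=s(R)=\frac{\log\log(1/\mathcal E)-\log(R-\mathcal E)}{\log(1/\mathcal E)}-1 .$$ (i) Let $0<\mathcal E<1$ and let $N$ be an integer with $N\ge\mathcal E^{-1}\log(1/\mathcal E)$, such that $R^*$ and $s(R^*)$ are well defined, i.e. $N\mathcal E\log(N\mathcal E)\ge 1$ and $R^*>\mathcal E$, and such that $0\le s(R^*)\le 1$. Then $$\frac{C_{N,\mathsf{BPSK}}}{N}\;\ge\;\left(1-2e^{-N\widetilde E(R^*)}\right)R^*-\frac{\log 2}{N}.$$ (ii) There is $\mathcal E_0\in(0,1]$ such that for all $0<\mathcal E<\mathcal E_0$ and all integers $N\ge\mathcal E^{-1}\log(1/\mathcal E)$ the quantities $R^*$ and $s(R^*)$ are well defined in this sense and $0\le s(R^*)\le 1$; hence the bound in (i) holds for all such $\mathcal E$ and $N$. -/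

import Mathlib

open scoped BigOperators ENNReal

noncomputable section

namespace QuantumCoding

/-- The Fock space of one optical mode, in the photon-number basis. -/
abbrev Mode : Type := lp (fun _ : ℕ => ℂ) 2

/-- The Hilbert space of `N` modes: the `N`-fold Hilbert tensor power of `Mode`, in the basis of
photon-number product vectors `|n₁⟩ ⊗ ⋯ ⊗ |n_N⟩`. -/
abbrev ModeBlock (N : ℕ) : Type := lp (fun _ : Fin N → ℕ => ℂ) 2

theorem memlp_coherent (α : ℂ) :
    Memℓp (fun n : ℕ =>
      (Real.exp (-‖α‖ ^ 2 / 2) : ℂ) * α ^ n / (Real.sqrt (n.factorial : ℝ) : ℂ)) 2 := by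
  apply memℓp_gen
  have h : Summable fun n : ℕ =>
      Real.exp (-‖α‖ ^ 2 / 2) ^ 2 * ((‖α‖ ^ 2) ^ n / (n.factorial : ℝ)) :=
    (Real.summable_pow_div_factorial (‖α‖ ^ 2)).mul_left _
  refine h.congr fun n => ?_
  have hs : Real.sqrt (n.factorial : ℝ) ^ 2 = (n.factorial : ℝ) :=
    Real.sq_sqrt (Nat.cast_nonneg _)
  simp only [ENNReal.toReal_ofNat, Real.rpow_ofNat, norm_div, norm_mul, norm_pow,
    Complex.norm_real, Real.norm_eq_abs, abs_of_nonneg (Real.sqrt_nonneg _),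
    abs_of_pos (Real.exp_pos _)]
  rw [div_pow, mul_pow, hs]
  ring

/-- The coherent state `|α⟩ = exp (-|α|² / 2) ∑ₙ (αⁿ / √(n!)) |n⟩`. -/
def coherent (α : ℂ) : Mode :=
  ⟨fun n : ℕ =>
    (Real.exp (-‖α‖ ^ 2 / 2) : ℂ) * α ^ n / (Real.sqrt (n.factorial : ℝ) : ℂ),
    memlp_coherent α⟩

theorem memlp_tensor {N : ℕ} (v : Fin N → Mode) :
    Memℓp (fun n : Fin N → ℕ => ∏ i, v i (n i)) 2 := by
  classical
  apply memℓp_gen' (C := ∏ i, ∑' m : ℕ, ‖v i m‖ ^ 2)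
  intro s
  have hsum : ∀ i, Summable fun m : ℕ => ‖v i m‖ ^ 2 := by
    intro i
    have h := (lp.memℓp (v i)).summable (by simp)
    simpa using h
  calc ∑ n ∈ s, ‖∏ i, v i (n i)‖ ^ (2 : ℝ≥0∞).toReal
      = ∑ n ∈ s, ∏ i, ‖v i (n i)‖ ^ 2 := by
        refine Finset.sum_congr rfl fun n _ => ?_
        simp [Finset.prod_pow]
    _ ≤ ∑ n ∈ Fintype.piFinset (fun i => s.image fun n => n i), ∏ i, ‖v i (n i)‖ ^ 2 := by
        refine Finset.sum_le_sum_of_subset_of_nonneg (fun n hn => ?_) fun n _ _ => ?_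
        · exact Fintype.mem_piFinset.2 fun i => Finset.mem_image_of_mem _ hn
        · exact Finset.prod_nonneg fun i _ => sq_nonneg _
    _ = ∏ i, ∑ m ∈ s.image (fun n => n i), ‖v i m‖ ^ 2 :=
        (Finset.prod_univ_sum (fun i => s.image fun n => n i) fun i m => ‖v i m‖ ^ 2).symm
    _ ≤ ∏ i, ∑' m : ℕ, ‖v i m‖ ^ 2 := by
        refine Finset.prod_le_prod (fun i _ => Finset.sum_nonneg fun _ _ => sq_nonneg _)
          fun i _ => (hsum i).sum_le_tsum _ fun _ _ => sq_nonneg _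

/-- The product vector `v₁ ⊗ ⋯ ⊗ v_N`. -/
def tensor {N : ℕ} (v : Fin N → Mode) : ModeBlock N :=
  ⟨fun n => ∏ i, v i (n i), memlp_tensor v⟩

/-- A projective measurement with outcomes in `Fin M`, acting jointly on all `N` modes:
mutually orthogonal orthogonal projections that resolve the identity. -/
structure JointMeasurement (N M : ℕ) where
  proj : Fin M → (ModeBlock N →L[ℂ] ModeBlock N)
  isStarProjection : ∀ k, IsStarProjection (proj k)
  orthogonal : ∀ k l, k ≠ l → proj k * proj l = 0
  sum_eq_one : ∑ k, proj k = 1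

/-- Transition probabilities `p(k | j)` of the superchannel made of the inner encoder `c`, the
memoryless channel `x ↦ ψ x` and the joint measurement `P` (Born rule). -/
def superchannel {X : Type} (ψ : X → Mode) {N M : ℕ} (c : Fin M → Fin N → X)
    (P : JointMeasurement N M) (j k : Fin M) : ℝ :=
  ‖P.proj k (tensor fun i => ψ (c j i))‖ ^ 2

/-- Mutual information, in nats, between the input (with law `p`) and the output of the discrete
channel with transition probabilities `W j k = W(k | j)`. -/
def mutualInfo {M : ℕ} (p : Fin M → ℝ) (W : Fin M → Fin M → ℝ) : ℝ :=
  ∑ j, ∑ k, p j * W j k * Real.log (W j k / ∑ i, p i * W i k)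

/-- `C_N`: the supremum of the mutual information of the superchannel over all numbers `M` of
messages, all inner codes of blocklength `N` with `M` messages, all joint measurements of
blocklength `N` that estimate the message, and all laws of the message. -/
def CN {X : Type} (ψ : X → Mode) (N : ℕ) : EReal :=
  ⨆ (M : ℕ) (c : Fin M → Fin N → X) (P : JointMeasurement N M)
    (p : stdSimplex ℝ (Fin M)), ((mutualInfo p (superchannel ψ c P) : ℝ) : EReal)

/-- The coherent-state BPSK alphabet `{|√ℰ⟩, |-√ℰ⟩}`. -/
def bpsk (ℰ : ℝ) (b : Bool) : Mode :=
  if b then coherent (-(Real.sqrt ℰ : ℂ)) else coherent (Real.sqrt ℰ : ℂ)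

/-- The rate `R*`. -/
def Rstar (ℰ : ℝ) (N : ℕ) : ℝ :=
  ℰ * Real.log (1 / ℰ) *
    (1 - Real.sqrt (Real.log (N * ℰ * Real.log (N * ℰ)) / (N * ℰ))) + ℰ

/-- The parameter `s` chosen at rate `R`. -/
def sParam (ℰ R : ℝ) : ℝ :=
  (Real.log (Real.log (1 / ℰ)) - Real.log (R - ℰ)) / Real.log (1 / ℰ) - 1

/-- The exponent `Ẽ(R)`. -/
def Etilde (ℰ R : ℝ) : ℝ :=
  -Real.log (((1 + Real.exp (-2 * ℰ)) / 2) ^ (1 + sParam ℰ R) +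
      ((1 - Real.exp (-2 * ℰ)) / 2) ^ (1 + sParam ℰ R)) - sParam ℰ R * R

/-- The formulas for `R*` and `s` at `R = R*` make sense over the reals (the argument of the
square root is nonnegative, the logarithms are taken of positive numbers), and `0 ≤ s ≤ 1`. -/
def Admissible (ℰ : ℝ) (N : ℕ) : Prop :=
  1 ≤ N * ℰ * Real.log (N * ℰ) ∧ ℰ < Rstar ℰ N ∧
    0 ≤ sParam ℰ (Rstar ℰ N) ∧ sParam ℰ (Rstar ℰ N) ≤ 1

end QuantumCoding

end

-- The uniform mixture of the `N`-mode BPSK states has eigenvalues μ_t, and in its eigenbasis the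
-- codeword x has coordinates √(μ_t) χ(x, t), with χ the ±1 Walsh characters
-- (`exists_orthonormal_tensor_bpsk`). Let A have M codewords ψ_j as columns and put G = A Aᵀ. The
-- square-root measurement gives orthonormal e_j with Σ_j Re⟨e_j, ψ_j⟩ = Tr √G
-- (`exists_orthonormal_sum_inner_eq_trace`), so the summed error is at most 2(M - Tr √G).
--
-- The bounds √G ≥ 0 and 2√G ≥ 3G - G² involve only the first two powers of G. Averaged over all
-- codes, they bound the contribution of μ_t by Mμ_t min(2, (M-1)μ_t) ≤ 2M(M-1)^s μ_t^(1+s)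
-- (`exists_code_sqrt_trace`), and the product structure turns Σ_t μ_t^(1+s) into an N-th power.
-- With M = ⌈e^(NR)⌉, Fano's inequality (`mutualInfo_uniform_ge`) gives `CN_bpsk_ge`; (i) is the
-- case R = R*.
--
-- For (ii), s(R*) = -log(1 - √δ)/log(1/ℰ) with δ = log(Nℰ log(Nℰ))/(Nℰ), and δ stays below a
-- constant less than 1.

namespace QuantumCoding

-- Isometries from equal Gram matrices

section Gram

variable {V H ι : Type*} [NormedAddCommGroup V] [InnerProductSpace ℂ V]
  [NormedAddCommGroup H] [InnerProductSpace ℂ H] [Fintype ι]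

theorem exists_linearIsometry_of_orthonormal_nat [FiniteDimensional ℂ V] {b : ℕ → H} (hb : Orthonormal ℂ b) :
    Nonempty (V →ₗᵢ[ℂ] H) := by
  let v := stdOrthonormalBasis ℂ V
  let f : V →ₗ[ℂ] H := v.toBasis.constr ℂ fun i => b i.val
  refine ⟨f.isometryOfOrthonormal (v := v.toBasis) (by simp) ?_⟩
  have : f ∘ v.toBasis = fun i => b i.val := by
    funext i
    simp only [Function.comp_apply, f, Module.Basis.constr_basis]
  rw [this]
  exact hb.comp _ Fin.val_injective

theorem norm_sum_smul_eq_of_gram_eq {x : ι → V} {y : ι → H}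
    (h : ∀ i j, inner ℂ (x i) (x j) = inner ℂ (y i) (y j)) (a : ι → ℂ) :
    ‖∑ i, a i • y i‖ = ‖∑ i, a i • x i‖ := by
  rw [@norm_eq_sqrt_re_inner ℂ, @norm_eq_sqrt_re_inner ℂ]
  simp only [sum_inner, inner_sum, inner_smul_left, inner_smul_right, h]

/-- Two finite families with the same Gram matrix are related by an isometry of the whole space,
provided the target has room for it. -/
theorem exists_linearIsometry_of_gram_eq [FiniteDimensional ℂ V] {b : ℕ → H} (hb : Orthonormal ℂ b)
    {x : ι → V} {y : ι → H} (h : ∀ i j, inner ℂ (x i) (x j) = inner ℂ (y i) (y j)) :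
    ∃ U : V →ₗᵢ[ℂ] H, ∀ i, U (x i) = y i := by
  classical
  obtain ⟨e⟩ := exists_linearIsometry_of_orthonormal_nat (V := V) hb
  -- Extending a partial isometry to the whole space needs finite dimension, so everything happens
  -- inside W.
  let W : Submodule ℂ H := LinearMap.range e.toLinearMap ⊔ Submodule.span ℂ (Set.range y)
  have : FiniteDimensional ℂ (Submodule.span ℂ (Set.range y)) :=
    FiniteDimensional.span_of_finite ℂ (Set.finite_range y)
  have : FiniteDimensional ℂ W := Submodule.finiteDimensional_sup _ _
  have heW : ∀ v, e v ∈ W := fun v => Submodule.mem_sup_left ⟨v, rfl⟩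
  have hyW : ∀ i, y i ∈ W := fun i =>
    Submodule.mem_sup_right (Submodule.subset_span ⟨i, rfl⟩)
  let X : (ι → ℂ) →ₗ[ℂ] W := Fintype.linearCombination ℂ fun i => (⟨e (x i), heW _⟩ : W)
  let Y : (ι → ℂ) →ₗ[ℂ] W := Fintype.linearCombination ℂ fun i => (⟨y i, hyW i⟩ : W)
  have hXY : ∀ a, ‖Y a‖ = ‖X a‖ := by
    intro a
    simp only [X, Y, Fintype.linearCombination_apply]
    refine norm_sum_smul_eq_of_gram_eq (fun i j => ?_) a
    simp only [Submodule.coe_inner, LinearIsometry.inner_map_map, h]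
  obtain ⟨g, hg⟩ := X.rangeRestrict.exists_rightInverse_of_surjective X.range_rangeRestrict
  have hg' : ∀ v : LinearMap.range X, X (g v) = v := fun v => by
    have := LinearMap.congr_fun hg v
    exact congrArg Subtype.val this
  -- Since ‖Y a‖ = ‖X a‖, the kernel of X lies in that of Y, so X a ↦ Y a does not depend on the
  -- section g.
  let L : LinearMap.range X →ₗᵢ[ℂ] W :=
    { toLinearMap := Y ∘ₗ g
      norm_map' := fun v => by
        simp only [LinearMap.comp_apply, hXY, hg', Submodule.coe_norm] }
  have hL : ∀ a, L ⟨X a, LinearMap.mem_range_self X a⟩ = Y a := by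
    intro a
    change Y (g ⟨X a, _⟩) = Y a
    rw [← sub_eq_zero, ← map_sub, ← norm_eq_zero, hXY, map_sub, hg', sub_self, norm_zero]
  let eW : V →ₗᵢ[ℂ] W :=
    { toLinearMap := e.toLinearMap.codRestrict W heW
      norm_map' := fun v => by simp [Submodule.coe_norm] }
  refine ⟨W.subtypeₗᵢ.comp (L.extend.comp eW), fun i => ?_⟩
  have hXi : X (Pi.single i 1) = eW (x i) := by
    simp [X, Fintype.linearCombination_apply_single]
    rfl
  have hYi : Y (Pi.single i 1) = ⟨y i, hyW i⟩ := by
    simp [Y, Fintype.linearCombination_apply_single]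
  have := L.extend_apply ⟨X (Pi.single i 1), LinearMap.mem_range_self X _⟩
  rw [hL, hYi] at this
  simp only [hXi] at this
  simp [this]

end Gram

-- Inner products of product and coherent states

section Tensor

/-- Absolute summability is carried through the induction because splitting off a mode multiplies
two infinite sums. -/
theorem summable_norm_prod {N : ℕ} {f : Fin N → ℕ → ℂ} (hf : ∀ i, Summable fun n => ‖f i n‖) :
    Summable (fun n : Fin N → ℕ => ‖∏ i, f i (n i)‖) ∧
      ∑' n : Fin N → ℕ, ∏ i, f i (n i) = ∏ i, ∑' n, f i n := by
  induction N with
  | zero =>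
    refine ⟨Summable.of_finite, ?_⟩
    simp [tsum_fintype]
  | succ N ih =>
    obtain ⟨h1, h2⟩ := ih (f := fun i => f i.succ) fun i => hf _
    let σ := Fin.consEquiv (fun _ : Fin (N + 1) => ℕ)
    constructor
    · rw [← σ.summable_iff]
      refine ((hf 0).mul_norm h1).congr fun p => ?_
      simp [σ, Fin.prod_univ_succ, Fin.consEquiv]
    · rw [← σ.tsum_eq, Fin.prod_univ_succ, ← h2, tsum_mul_tsum_of_summable_norm (hf 0) h1]
      refine tsum_congr fun p => ?_
      simp [σ, Fin.prod_univ_succ, Fin.consEquiv]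

theorem inner_tensor {N : ℕ} (v w : Fin N → Mode) :
    inner ℂ (tensor v) (tensor w) = ∏ i, inner ℂ (v i) (w i) := by
  have hs : ∀ i, Summable fun n => ‖inner ℂ (v i n) (w i n)‖ := fun i =>
    (lp.summable_inner (𝕜 := ℂ) (v i) (w i)).norm
  simp only [lp.inner_eq_tsum]
  rw [← (summable_norm_prod hs).2]
  refine tsum_congr fun n => ?_
  simp [tensor, Finset.prod_mul_distrib]

theorem inner_coherent_ofReal (a b : ℝ) :
    inner ℂ (coherent a) (coherent b) = (Real.exp (-(a - b) ^ 2 / 2) : ℂ) := by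
  rw [lp.inner_eq_tsum]
  have h : ∀ n : ℕ, inner ℂ (coherent a n) (coherent b n) =
      (Real.exp (-a ^ 2 / 2) * Real.exp (-b ^ 2 / 2) : ℝ) * (((a * b) ^ n / n.factorial : ℝ) : ℂ) := by
    intro n
    have hs : ((Real.sqrt n.factorial : ℝ) : ℂ) * (Real.sqrt n.factorial : ℝ) = n.factorial := by
      rw [← Complex.ofReal_mul, Real.mul_self_sqrt (Nat.cast_nonneg _), Complex.ofReal_natCast]
    simp only [coherent, RCLike.inner_apply, map_div₀, map_mul, map_pow, Complex.conj_ofReal,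
      Complex.norm_real, Real.norm_eq_abs, sq_abs]
    rw [div_mul_div_comm, hs]
    push_cast
    ring
  rw [tsum_congr h, tsum_mul_left, ← Complex.ofReal_tsum, ← Complex.ofReal_mul,
    (NormedSpace.expSeries_div_hasSum_exp (a * b)).tsum_eq, ← Real.exp_eq_exp_ℝ,
    ← Real.exp_add, ← Real.exp_add]
  congr 2
  ring

theorem inner_bpsk {ℰ : ℝ} (h : 0 < ℰ) (x y : Bool) :
    inner ℂ (bpsk ℰ x) (bpsk ℰ y) = ((if x = y then 1 else Real.exp (-2 * ℰ) : ℝ) : ℂ) := by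
  have e : ∀ x, bpsk ℰ x = coherent ((if x then -Real.sqrt ℰ else Real.sqrt ℰ : ℝ) : ℂ) := by
    intro x; cases x <;> simp [bpsk]
  rw [e, e, inner_coherent_ofReal]
  have hs := Real.sq_sqrt h.le
  congr 1
  cases x <;> cases y <;> simp <;> ring_nf <;> rw [hs]

/-- The number states |n, …, n⟩ suffice; for N = 0 the space is one-dimensional. -/
theorem exists_orthonormal_nat_modeBlock {N : ℕ} (hN : 0 < N) :
    ∃ b : ℕ → ModeBlock N, Orthonormal ℂ b := by
  classical
  refine ⟨fun n => lp.single 2 (fun _ : Fin N => n) (1 : ℂ), ?_⟩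
  rw [orthonormal_iff_ite]
  intro i j
  rw [lp.inner_single_left]
  have : ((fun _ : Fin N => i) = fun _ => j) ↔ i = j :=
    ⟨fun h => congrFun h ⟨0, hN⟩, fun h => by rw [h]⟩
  by_cases h : i = j
  · simp [h]
  · rw [if_neg h, lp.single_apply_ne]
    · simp
    · simpa [this] using h

end Tensor

-- Projective measurements

section Measurement

variable {N M : ℕ}

theorem isStarProjection_sum_rankOne {e : Fin M → ModeBlock N} (he : Orthonormal ℂ e)
    (s : Finset (Fin M)) :
    IsStarProjection (∑ i ∈ s, InnerProductSpace.rankOne ℂ (e i) (e i)) := by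
  classical
  have hp := fun i => InnerProductSpace.isStarProjection_rankOne_self (𝕜 := ℂ) (he.1 i)
  refine ⟨?_, ?_⟩
  · unfold IsIdempotentElem
    ext1 v
    simp [orthonormal_iff_ite.1 he]
  · exact isSelfAdjoint_sum _ fun i _ => (hp i).isSelfAdjoint

/-- The von Neumann measurement in an orthonormal family; the complement of the span of the family
is added to one of the outcomes. -/
theorem exists_jointMeasurement_of_orthonormal (hM : 0 < M) {e : Fin M → ModeBlock N}
    (he : Orthonormal ℂ e) :
    ∃ P : JointMeasurement N M, ∀ k v, ‖inner ℂ (e k) v‖ ≤ ‖P.proj k v‖ := by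
  classical
  let k₀ : Fin M := ⟨0, hM⟩
  let Q : Fin M → (ModeBlock N →L[ℂ] ModeBlock N) := fun i => InnerProductSpace.rankOne ℂ (e i) (e i)
  let R := ∑ i ∈ Finset.univ.erase k₀, Q i
  have hR : IsStarProjection R := isStarProjection_sum_rankOne he _
  have hQ : ∀ k, IsStarProjection (Q k) := fun k =>
    InnerProductSpace.isStarProjection_rankOne_self (he.1 k)
  have hQQ : ∀ k l, k ≠ l → Q k * Q l = 0 := by
    intro k l hkl
    ext1 v
    simp [Q, orthonormal_iff_ite.1 he, hkl]
  have hQR : ∀ k, k ≠ k₀ → Q k * R = Q k := by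
    intro k hk
    rw [Finset.mul_sum, Finset.sum_eq_single k (fun i _ hi => hQQ _ _ hi.symm)
      (fun h => absurd (Finset.mem_erase.2 ⟨hk, Finset.mem_univ _⟩) h)]
    exact (hQ k).isIdempotentElem
  have hRQ : ∀ k, k ≠ k₀ → R * Q k = Q k := by
    intro k hk
    rw [Finset.sum_mul, Finset.sum_eq_single k (fun i _ hi => hQQ _ _ hi)
      (fun h => absurd (Finset.mem_erase.2 ⟨hk, Finset.mem_univ _⟩) h)]
    exact (hQ k).isIdempotentElem
  have hRe : R (e k₀) = 0 := by
    simp only [R, Q, sum_apply, InnerProductSpace.rankOne_apply]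
    refine Finset.sum_eq_zero fun i hi => ?_
    rw [orthonormal_iff_ite.1 he, if_neg (Finset.ne_of_mem_erase hi), zero_smul]
  let P : JointMeasurement N M :=
    { proj := fun k => if k = k₀ then 1 - R else Q k
      isStarProjection := fun k => by
        split_ifs
        exacts [hR.one_sub, hQ k]
      orthogonal := fun k l hkl => by
        by_cases hk : k = k₀
        · have hl : l ≠ k₀ := fun h => hkl (hk.trans h.symm)
          simp [hk, hl, sub_mul, hRQ l hl]
        · by_cases hl : l = k₀
          · simp [hk, hl, mul_sub, hQR k hk]
          · simp [hk, hl, hQQ k l hkl]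
      sum_eq_one := by
        rw [← Finset.add_sum_erase _ _ (Finset.mem_univ k₀), if_pos rfl,
          Finset.sum_congr rfl fun i hi => if_neg (Finset.ne_of_mem_erase hi)]
        exact sub_add_cancel _ _ }
  have hPe : ∀ k, P.proj k (e k) = e k := by
    intro k
    by_cases hk : k = k₀
    · simp [P, hk, hRe]
    · have := he.1 k
      simp [P, hk, Q, this]
  refine ⟨P, fun k v => ?_⟩
  have hsym : inner ℂ (e k) v = inner ℂ (e k) (P.proj k v) := by
    conv_lhs => rw [← hPe k]
    rw [← ContinuousLinearMap.adjoint_inner_right, ← ContinuousLinearMap.star_eq_adjoint,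
      (P.isStarProjection k).isSelfAdjoint.star_eq]
  rw [hsym]
  simpa [he.1 k] using norm_inner_le_norm (𝕜 := ℂ) (e k) (P.proj k v)

theorem JointMeasurement.sum_norm_sq (P : JointMeasurement N M) (v : ModeBlock N) :
    ∑ k, ‖P.proj k v‖ ^ 2 = ‖v‖ ^ 2 := by
  have h : ∀ k, ‖P.proj k v‖ ^ 2 = RCLike.re (inner ℂ v (P.proj k v)) := by
    intro k
    rw [@norm_sq_eq_re_inner ℂ, ← ContinuousLinearMap.adjoint_inner_right,
      ← ContinuousLinearMap.star_eq_adjoint, (P.isStarProjection k).isSelfAdjoint.star_eq,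
      ← mul_apply_eq_comp, (P.isStarProjection k).isIdempotentElem]
  simp_rw [h]
  rw [← map_sum, ← inner_sum, ← sum_apply, P.sum_eq_one]
  simp [@norm_sq_eq_re_inner ℂ]

end Measurement

end QuantumCoding

noncomputable section

namespace QuantumCoding

-- Operator inequality for the square root

section Sqrt

variable {T : Type*} [Fintype T] [DecidableEq T]

open scoped MatrixOrder in
/-- A real positive semidefinite matrix has a symmetric square root whose diagonal dominates both
`0` and that of `(3 G - G²) / 2`, because `S⁴ - 3 S² + 2 S = (S - 1) (S² + 2 S) (S - 1) ≥ 0`. -/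
theorem exists_sqrt_diag_ge {G : Matrix T T ℝ} (hG : G.PosSemidef) :
    ∃ S : Matrix T T ℝ, S.transpose = S ∧ S * S = G ∧
      ∀ t, 0 ≤ S t t ∧ 3 * G t t - (G * G) t t ≤ 2 * S t t := by
  have hS : (CFC.sqrt G).PosSemidef := Matrix.nonneg_iff_posSemidef.1 (CFC.sqrt_nonneg G)
  have hSS : CFC.sqrt G * CFC.sqrt G = G := CFC.sqrt_mul_sqrt_self G hG.nonneg
  generalize CFC.sqrt G = S at hS hSS
  have hT : S.transpose = S := by
    simpa only [Matrix.conjTranspose_eq_transpose_of_trivial] using hS.isHermitian.eq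
  refine ⟨S, hT, hSS, fun t => ⟨hS.diag_nonneg, ?_⟩⟩
  have h1 : (S * S + 2 • S).PosSemidef := by
    rw [hSS, two_smul]
    exact hG.add (hS.add hS)
  have h2 := (h1.conjTranspose_mul_mul_same (S - 1)).diag_nonneg (i := t)
  have h3 : (S - 1).conjTranspose * (S * S + 2 • S) * (S - 1) = G * G - 3 • G + 2 • S := by
    rw [Matrix.conjTranspose_sub, hS.isHermitian.eq, Matrix.conjTranspose_one, ← hSS]
    noncomm_ring
  have h4 : (3 • G) t t = 3 * G t t := by simp [Matrix.smul_apply]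
  have h5 : (2 • S) t t = 2 * S t t := by simp [Matrix.smul_apply]
  rw [h3] at h2
  rw [Matrix.add_apply, Matrix.sub_apply, h4, h5] at h2
  linarith

end Sqrt

-- Square-root measurement

section Decoder

variable {T H : Type*} [Fintype T] [DecidableEq T] [NormedAddCommGroup H] [InnerProductSpace ℂ H]

/-- The square-root measurement, realised by an orthonormal family: the overlaps with the signal
vectors `∑ₜ A t j • f t` sum to the trace of `(A Aᵀ)^(1/2)`. -/
theorem exists_orthonormal_sum_inner_eq_trace {b : ℕ → H} (hb : Orthonormal ℂ b) {M : ℕ}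
    {f : T → H} (hf : Orthonormal ℂ f) {A : Matrix T (Fin M) ℝ} {S : Matrix T T ℝ}
    (hST : S.transpose = S) (hS : S * S = A * A.transpose) :
    ∃ e : Fin M → H, Orthonormal ℂ e ∧
      ∑ j, RCLike.re (inner ℂ (e j) (∑ t, (A t j : ℂ) • f t)) = ∑ t, S t t := by
  -- The rows of A and those of S have the same Gram matrix; the isometry matching them is the polar
  -- factor of A. It is defined on all of ℂ^M, so the basis images are orthonormal even if the
  -- codewords are dependent.
  let a : T → EuclideanSpace ℂ (Fin M) := fun t => WithLp.toLp 2 fun j => (A t j : ℂ)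
  let s : T → H := fun t => ∑ t', (S t t' : ℂ) • f t'
  have hgram : ∀ t t', inner ℂ (a t) (a t') = inner ℂ (s t) (s t') := by
    intro t t'
    rw [hf.inner_sum]
    have h := congrFun (congrFun hS t) t'
    conv at h => lhs; rw [← hST]; arg 1; rw [hST]
    simp only [Matrix.mul_apply, Matrix.transpose_apply] at h
    simp only [PiLp.inner_apply, a, RCLike.inner_apply, Complex.conj_ofReal]
    have h' := congrArg (fun r : ℝ => (r : ℂ)) h
    push_cast at h'
    rw [h']
    exact Finset.sum_congr rfl fun _ _ => mul_comm _ _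
  obtain ⟨U, hU⟩ := exists_linearIsometry_of_gram_eq hb hgram
  have ha : ∀ t, a t = ∑ j, (A t j : ℂ) • EuclideanSpace.single j (1 : ℂ) := by
    intro t
    ext j
    simp [a, Pi.single_apply]
  refine ⟨fun j => U (EuclideanSpace.single j 1),
    EuclideanSpace.orthonormal_single.comp_linearIsometry U, ?_⟩
  have hst : ∀ t, inner ℂ (s t) (f t) = (S t t : ℂ) := by
    intro t
    simp [s, orthonormal_iff_ite.1 hf]
  rw [← map_sum]
  have : ∑ j, inner ℂ (U (EuclideanSpace.single j 1)) (∑ t, (A t j : ℂ) • f t) =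
      ∑ t, (S t t : ℂ) := by
    simp only [← hst, ← hU, ha, map_sum, map_smul, inner_sum, sum_inner, inner_smul_left,
      inner_smul_right, Complex.conj_ofReal]
    exact Finset.sum_comm
  rw [this, ← Complex.ofReal_sum]
  simp

end Decoder

-- Averaging over all codes

section RandomCoding

variable {X T : Type*}

/-- For a uniformly random code, codewords at different indices are independent, so the mixed moment
factors into zero means. -/
theorem sum_code_mul_eq_zero [Fintype X] {M : ℕ} {h : X → ℝ} (h0 : ∑ x, h x = 0) {j k : Fin M} (hjk : j ≠ k) :
    ∑ c : Fin M → X, h (c j) * h (c k) = 0 := by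
  classical
  have e : ∀ c : Fin M → X, h (c j) * h (c k) =
      ∏ i, (if i = j then h (c i) else 1) * (if i = k then h (c i) else 1) := by
    intro c
    rw [Finset.prod_mul_distrib, Finset.prod_ite_eq', Finset.prod_ite_eq']
    simp
  simp_rw [e]
  rw [← Fintype.prod_sum fun i x =>
    (if i = j then h x else 1) * (if i = k then h x else 1)]
  refine Finset.prod_eq_zero (Finset.mem_univ j) ?_
  simp [hjk, h0]

theorem sum_code_sq [Fintype X] {M : ℕ} {h : X → ℝ} (h0 : ∑ x, h x = 0) (h1 : ∀ x, h x ^ 2 = 1) :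
    ∑ c : Fin M → X, (∑ j, h (c j)) ^ 2 = Fintype.card (Fin M → X) * M := by
  classical
  have : ∀ j : Fin M, ∑ k, ∑ c : Fin M → X, h (c j) * h (c k) = Fintype.card (Fin M → X) := by
    intro j
    rw [Finset.sum_eq_single j (fun k _ hk => sum_code_mul_eq_zero h0 hk.symm) (by simp)]
    simp [← sq, h1]
  simp_rw [sq, Finset.sum_mul_sum]
  rw [Finset.sum_comm]
  have h2 : ∀ j : Fin M, ∑ c : Fin M → X, ∑ k, h (c j) * h (c k) = Fintype.card (Fin M → X) :=
    fun j => by rw [Finset.sum_comm, this]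
  simp_rw [h2]
  simp [mul_comm]

/-- The matrix whose columns are the codewords of `c`, in coordinates `√(μ t) χ(x, t)`. -/
def codeMatrix {M : ℕ} (χ : X → T → ℝ) (μ : T → ℝ) (c : Fin M → X) : Matrix T (Fin M) ℝ :=
  fun t j => Real.sqrt (μ t) * χ (c j) t

variable {χ : X → T → ℝ} {μ : T → ℝ} {M : ℕ}

theorem codeMatrix_gram_apply (c : Fin M → X) (t t' : T) :
    (codeMatrix χ μ c * (codeMatrix χ μ c).transpose) t t' =
      Real.sqrt (μ t) * Real.sqrt (μ t') * ∑ j, χ (c j) t * χ (c j) t' := by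
  simp only [Matrix.mul_apply, Matrix.transpose_apply, codeMatrix, Finset.mul_sum]
  exact Finset.sum_congr rfl fun _ _ => by ring

theorem codeMatrix_gram_diag (hχ : ∀ x t, χ x t ^ 2 = 1) (hμ : ∀ t, 0 ≤ μ t) (c : Fin M → X)
    (t : T) : (codeMatrix χ μ c * (codeMatrix χ μ c).transpose) t t = M * μ t := by
  rw [codeMatrix_gram_apply, Real.mul_self_sqrt (hμ t)]
  simp [← sq, hχ, mul_comm]

/-- For t' ≠ t the products χ(·, t)χ(·, t') are centred signs and their sum over the M codewords has
second moment M; for t' = t the sum is M exactly. Weighting by μ_t μ_t' and using Σ μ = 1 gives the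
value. -/
theorem sum_codeMatrix_gram_sq_diag [Fintype X] [Fintype T] [DecidableEq T]
    (hχ : ∀ x t, χ x t ^ 2 = 1)
    (horth : ∀ t t', t ≠ t' → ∑ x, χ x t * χ x t' = 0) (hμ : ∀ t, 0 ≤ μ t) (hμ1 : ∑ t, μ t = 1)
    (t : T) :
    ∑ c : Fin M → X, ((codeMatrix χ μ c * (codeMatrix χ μ c).transpose) *
        (codeMatrix χ μ c * (codeMatrix χ μ c).transpose)) t t =
      Fintype.card (Fin M → X) * (M * μ t + M * (M - 1) * μ t ^ 2) := by
  have h1 : ∀ c : Fin M → X, ((codeMatrix χ μ c * (codeMatrix χ μ c).transpose) *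
        (codeMatrix χ μ c * (codeMatrix χ μ c).transpose)) t t =
      ∑ t', μ t * μ t' * (∑ j, χ (c j) t * χ (c j) t') ^ 2 := by
    intro c
    rw [Matrix.mul_apply]
    refine Finset.sum_congr rfl fun t' _ => ?_
    rw [codeMatrix_gram_apply, codeMatrix_gram_apply]
    simp only [mul_comm (χ _ t') (χ _ t)]
    have e1 := Real.mul_self_sqrt (hμ t)
    have e2 := Real.mul_self_sqrt (hμ t')
    calc _ = (Real.sqrt (μ t) * Real.sqrt (μ t)) * (Real.sqrt (μ t') * Real.sqrt (μ t')) *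
          (∑ j, χ (c j) t * χ (c j) t') ^ 2 := by ring
      _ = _ := by rw [e1, e2]
  have h2 : ∀ t', ∑ c : Fin M → X, μ t * μ t' * (∑ j, χ (c j) t * χ (c j) t') ^ 2 =
      Fintype.card (Fin M → X) * (M * μ t * μ t' + if t' = t then M * (M - 1) * μ t ^ 2 else 0) := by
    intro t'
    rw [← Finset.mul_sum]
    split_ifs with h
    · subst h
      simp only [← sq, hχ]
      simp
      ring
    · rw [sum_code_sq (h := fun x => χ x t * χ x t') (horth t t' (Ne.symm h))
        fun x => by rw [mul_pow, hχ, hχ, one_mul]]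
      ring
  simp_rw [h1]
  rw [Finset.sum_comm]
  simp_rw [h2]
  rw [← Finset.mul_sum, Finset.sum_add_distrib, ← Finset.mul_sum, hμ1]
  simp

/-- This interpolation is where the free exponent s enters. -/
theorem min_two_le_two_mul_rpow {x s : ℝ} (hx : 0 ≤ x) (hs0 : 0 ≤ s) (hs1 : s ≤ 1) :
    min 2 x ≤ 2 * x ^ s := by
  rcases le_total x 1 with h | h
  · rcases hx.eq_or_lt with rfl | hx
    · rw [min_eq_right (by norm_num)]
      positivity
    · have : x ^ (1 : ℝ) ≤ x ^ s := Real.rpow_le_rpow_of_exponent_ge hx h hs1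
      rw [Real.rpow_one] at this
      exact (min_le_right _ _).trans (by linarith)
  · have := Real.one_le_rpow h hs0
    exact (min_le_left _ _).trans (by linarith)

/-- Random coding: some code has a square root of its Gram operator with a large trace. -/
theorem exists_code_sqrt_trace [Fintype X] [Fintype T] [DecidableEq T] [Nonempty X] (hM : 0 < M) (hχ : ∀ x t, χ x t ^ 2 = 1)
    (horth : ∀ t t', t ≠ t' → ∑ x, χ x t * χ x t' = 0) (hμ : ∀ t, 0 ≤ μ t) (hμ1 : ∑ t, μ t = 1)
    {s : ℝ} (hs0 : 0 ≤ s) (hs1 : s ≤ 1) :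
    ∃ (c : Fin M → X) (S : Matrix T T ℝ), S.transpose = S ∧
      S * S = codeMatrix χ μ c * (codeMatrix χ μ c).transpose ∧
      2 * (M - ∑ t, S t t) ≤ M * (2 * ((M : ℝ) - 1) ^ s * ∑ t, μ t ^ (1 + s)) := by
  have hM1 : (0 : ℝ) ≤ (M : ℝ) - 1 := by
    have : (1 : ℝ) ≤ M := by exact_mod_cast hM
    linarith
  have hpsd : ∀ c : Fin M → X,
      (codeMatrix χ μ c * (codeMatrix χ μ c).transpose).PosSemidef := by
    intro c
    have := Matrix.posSemidef_self_mul_conjTranspose (codeMatrix χ μ c)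
    simpa only [Matrix.conjTranspose_eq_transpose_of_trivial] using this
  choose S hST hSS hSd using fun c => exists_sqrt_diag_ge (hpsd c)
  have hcard : (0 : ℝ) < Fintype.card (Fin M → X) := by exact_mod_cast Fintype.card_pos
  have ht : ∀ t, ∑ c : Fin M → X, 2 * (M * μ t - S c t t) ≤
      Fintype.card (Fin M → X) * (M * (2 * ((M : ℝ) - 1) ^ s * μ t ^ (1 + s))) := by
    -- `b1` uses only S_tt ≥ 0 and is the better bound for large (M-1)μ_t; `b2` uses 2S ≥ 3G - G²
    -- and wins for small.
    intro t
    have b1 : ∑ c : Fin M → X, 2 * (M * μ t - S c t t) ≤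
        Fintype.card (Fin M → X) * (M * μ t * 2) := by
      calc _ ≤ ∑ c : Fin M → X, M * μ t * 2 :=
            Finset.sum_le_sum fun c _ => by linarith [(hSd c t).1]
        _ = _ := by simp
    have b2 : ∑ c : Fin M → X, 2 * (M * μ t - S c t t) ≤
        Fintype.card (Fin M → X) * (M * μ t * ((M - 1) * μ t)) := by
      calc _ ≤ ∑ c : Fin M → X, (((codeMatrix χ μ c * (codeMatrix χ μ c).transpose) *
                (codeMatrix χ μ c * (codeMatrix χ μ c).transpose)) t t - M * μ t) :=
            Finset.sum_le_sum fun c _ => by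
              have := (hSd c t).2
              rw [codeMatrix_gram_diag hχ hμ] at this
              linarith
        _ = _ := by
            rw [Finset.sum_sub_distrib, sum_codeMatrix_gram_sq_diag hχ horth hμ hμ1]
            simp
            ring
    have b3 : ∑ c : Fin M → X, 2 * (M * μ t - S c t t) ≤
        Fintype.card (Fin M → X) * (M * μ t * min 2 ((M - 1) * μ t)) := by
      rcases min_choice (2 : ℝ) ((M - 1) * μ t) with h | h <;> rw [h] <;> assumption
    refine b3.trans ?_
    have hx : 0 ≤ (M - 1) * μ t := mul_nonneg hM1 (hμ t)
    have hm := min_two_le_two_mul_rpow hx hs0 hs1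
    have hMμ : 0 ≤ M * μ t := mul_nonneg (Nat.cast_nonneg _) (hμ t)
    calc (Fintype.card (Fin M → X) : ℝ) * (M * μ t * min 2 ((M - 1) * μ t))
        ≤ Fintype.card (Fin M → X) * (M * μ t * (2 * ((M - 1) * μ t) ^ s)) := by gcongr
      _ = _ := by
        rw [Real.mul_rpow hM1 (hμ t), Real.rpow_one_add' (hμ t) (by linarith)]
        ring
  have hsum : ∑ c : Fin M → X, 2 * (M - ∑ t, S c t t) ≤
      ∑ _c : Fin M → X, M * (2 * ((M : ℝ) - 1) ^ s * ∑ t, μ t ^ (1 + s)) := by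
    have e : ∀ c : Fin M → X, 2 * (M - ∑ t, S c t t) = ∑ t, 2 * (M * μ t - S c t t) := by
      intro c
      rw [← Finset.mul_sum, Finset.sum_sub_distrib, ← Finset.mul_sum, hμ1, mul_one]
    simp_rw [e]
    rw [Finset.sum_comm]
    refine (Finset.sum_le_sum fun t _ => ht t).trans_eq ?_
    rw [← Finset.mul_sum, ← Finset.mul_sum, ← Finset.mul_sum]
    simp
  obtain ⟨c, -, hc⟩ := Finset.exists_le_of_sum_le Finset.univ_nonempty hsum
  exact ⟨c, S c, hST c, hSS c, hc⟩

end RandomCoding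

-- Spectrum and random coding for BPSK

section Bpsk

/-- The eigenvalues `(1 ± exp (-2ℰ)) / 2` of the average BPSK state. -/
def bpskEigenvalue (ℰ : ℝ) (b : Bool) : ℝ :=
  if b then (1 - Real.exp (-2 * ℰ)) / 2 else (1 + Real.exp (-2 * ℰ)) / 2

/-- The characters of `(ℤ/2)^N`. -/
def walsh {N : ℕ} (x t : Fin N → Bool) : ℝ :=
  ∏ i, if x i && t i then -1 else 1

theorem walsh_sq {N : ℕ} (x t : Fin N → Bool) : walsh x t ^ 2 = 1 := by
  rw [walsh, ← Finset.prod_pow]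
  exact Finset.prod_eq_one fun i _ => by split_ifs <;> norm_num

theorem sum_walsh_mul_walsh {N : ℕ} {t t' : Fin N → Bool} (h : t ≠ t') :
    ∑ x, walsh x t * walsh x t' = 0 := by
  obtain ⟨i, hi⟩ := Function.ne_iff.1 h
  simp only [walsh, ← Finset.prod_mul_distrib]
  rw [← Fintype.prod_sum fun i b =>
    (if b && t i then (-1 : ℝ) else 1) * (if b && t' i then -1 else 1)]
  refine Finset.prod_eq_zero (Finset.mem_univ i) ?_
  revert hi
  cases t i <;> cases t' i <;> simp

theorem bpskEigenvalue_nonneg {ℰ : ℝ} (h : 0 < ℰ) (b : Bool) : 0 ≤ bpskEigenvalue ℰ b := by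
  have h1 : Real.exp (-2 * ℰ) ≤ 1 := Real.exp_le_one_iff.2 (by linarith)
  have h2 := Real.exp_pos (-2 * ℰ)
  cases b <;> simp only [bpskEigenvalue, if_true, Bool.false_eq_true, if_false] <;> linarith

/-- The spectrum of the `N`-fold average state. -/
def blockEigenvalue (ℰ : ℝ) {N : ℕ} (t : Fin N → Bool) : ℝ := ∏ i, bpskEigenvalue ℰ (t i)

theorem blockEigenvalue_nonneg {ℰ : ℝ} (h : 0 < ℰ) {N : ℕ} (t : Fin N → Bool) :
    0 ≤ blockEigenvalue ℰ t :=
  Finset.prod_nonneg fun _ _ => bpskEigenvalue_nonneg h _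

theorem sum_blockEigenvalue_rpow {ℰ : ℝ} (h : 0 < ℰ) (N : ℕ) (r : ℝ) :
    ∑ t : Fin N → Bool, blockEigenvalue ℰ t ^ r =
      (((1 + Real.exp (-2 * ℰ)) / 2) ^ r + ((1 - Real.exp (-2 * ℰ)) / 2) ^ r) ^ N := by
  have e : ∀ t : Fin N → Bool, blockEigenvalue ℰ t ^ r = ∏ i, bpskEigenvalue ℰ (t i) ^ r :=
    fun t => (Real.finsetProd_rpow _ _ (fun _ _ => bpskEigenvalue_nonneg h _) r).symm
  simp_rw [e]
  rw [← Fintype.prod_sum fun (_ : Fin N) b => bpskEigenvalue ℰ b ^ r]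
  simp [bpskEigenvalue, add_comm]

theorem sum_blockEigenvalue {ℰ : ℝ} (h : 0 < ℰ) (N : ℕ) :
    ∑ t : Fin N → Bool, blockEigenvalue ℰ t = 1 := by
  have := sum_blockEigenvalue_rpow h N 1
  simp only [Real.rpow_one] at this
  rw [this]
  ring_nf

/-- In a suitable orthonormal family the BPSK product states have coordinates `√(μ t) χ(x, t)`. -/
theorem exists_orthonormal_tensor_bpsk {ℰ : ℝ} (h : 0 < ℰ) {N : ℕ} (hN : 0 < N) :
    ∃ f : (Fin N → Bool) → ModeBlock N, Orthonormal ℂ f ∧ ∀ x : Fin N → Bool,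
      tensor (fun i => bpsk ℰ (x i)) =
        ∑ t, ((Real.sqrt (blockEigenvalue ℰ t) * walsh x t : ℝ) : ℂ) • f t := by
  obtain ⟨b, hb⟩ := exists_orthonormal_nat_modeBlock hN
  let a : (Fin N → Bool) → EuclideanSpace ℂ (Fin N → Bool) := fun x =>
    WithLp.toLp 2 fun t => ((Real.sqrt (blockEigenvalue ℰ t) * walsh x t : ℝ) : ℂ)
  have hgram : ∀ x y, inner ℂ (a x) (a y) =
      inner ℂ (tensor fun i => bpsk ℰ (x i)) (tensor fun i => bpsk ℰ (y i)) := by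
    intro x y
    rw [inner_tensor]
    simp only [inner_bpsk h, ← Complex.ofReal_prod]
    simp only [PiLp.inner_apply, a, RCLike.inner_apply, Complex.conj_ofReal,
      ← Complex.ofReal_mul, ← Complex.ofReal_sum]
    congr 1
    have e : ∀ t, Real.sqrt (blockEigenvalue ℰ t) * walsh y t *
        (Real.sqrt (blockEigenvalue ℰ t) * walsh x t) =
        ∏ i, bpskEigenvalue ℰ (t i) *
          ((if y i && t i then (-1 : ℝ) else 1) * (if x i && t i then -1 else 1)) := by
      intro t
      rw [Finset.prod_mul_distrib, Finset.prod_mul_distrib]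
      have := Real.mul_self_sqrt (blockEigenvalue_nonneg h t)
      calc _ = (Real.sqrt (blockEigenvalue ℰ t) * Real.sqrt (blockEigenvalue ℰ t)) *
            (walsh y t * walsh x t) := by ring
        _ = _ := by rw [this]; rfl
    simp_rw [e]
    rw [← Fintype.prod_sum fun i c => bpskEigenvalue ℰ c *
          ((if y i && c then (-1 : ℝ) else 1) * (if x i && c then -1 else 1))]
    -- Mode by mode, the eigenvalues have sum 1 and difference exp (-2ℰ), which are the two possible
    -- overlaps.
    refine Finset.prod_congr rfl fun i _ => ?_
    cases x i <;> cases y i <;> simp [bpskEigenvalue] <;> ring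
  obtain ⟨U, hU⟩ := exists_linearIsometry_of_gram_eq hb hgram
  refine ⟨fun t => U (EuclideanSpace.single t 1),
    EuclideanSpace.orthonormal_single.comp_linearIsometry U, fun x => ?_⟩
  rw [← hU]
  simp only [← map_smul, ← map_sum]
  congr 1
  ext t
  simp [a, Pi.single_apply]

/-- Random-coding bound for BPSK: some code and joint measurement have average error probability
at most `2 (M - 1)^s (Tr ρ^(1 + s))^N`. -/
theorem exists_code_measurement {ℰ : ℝ} (h : 0 < ℰ) {N M : ℕ} (hN : 0 < N) (hM : 0 < M)
    {s : ℝ} (hs0 : 0 ≤ s) (hs1 : s ≤ 1) :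
    ∃ (c : Fin M → Fin N → Bool) (P : JointMeasurement N M),
      ∑ j, (1 - superchannel (bpsk ℰ) c P j j) ≤
        M * (2 * ((M : ℝ) - 1) ^ s * (((1 + Real.exp (-2 * ℰ)) / 2) ^ (1 + s) +
          ((1 - Real.exp (-2 * ℰ)) / 2) ^ (1 + s)) ^ N) := by
  obtain ⟨b, hb⟩ := exists_orthonormal_nat_modeBlock hN
  obtain ⟨f, hf, hψ⟩ := exists_orthonormal_tensor_bpsk h hN
  obtain ⟨c, S, hST, hSS, hS⟩ := exists_code_sqrt_trace (X := Fin N → Bool) hM walsh_sq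
    (fun t t' => sum_walsh_mul_walsh) (blockEigenvalue_nonneg h) (sum_blockEigenvalue h N) hs0 hs1
  obtain ⟨e, he, htr⟩ := exists_orthonormal_sum_inner_eq_trace hb hf hST hSS
  obtain ⟨P, hP⟩ := exists_jointMeasurement_of_orthonormal hM he
  refine ⟨c, P, le_trans ?_ (hS.trans_eq (by rw [sum_blockEigenvalue_rpow h]))⟩
  rw [← htr]
  -- 1 - r² ≤ 2(1 - r), with r the norm of the projected state.
  have hj : ∀ j, 1 - superchannel (bpsk ℰ) c P j j ≤ 2 * (1 - RCLike.re (inner ℂ (e j)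
      (∑ t, (codeMatrix walsh (blockEigenvalue ℰ) c t j : ℂ) • f t))) := by
    intro j
    have h1 := hP j (tensor fun i => bpsk ℰ (c j i))
    simp only [codeMatrix]
    rw [← hψ (c j), superchannel]
    have h2 := (RCLike.re_le_norm (inner ℂ (e j) (tensor fun i => bpsk ℰ (c j i)))).trans h1
    nlinarith [sq_nonneg (‖P.proj j (tensor fun i => bpsk ℰ (c j i))‖ - 1)]
  refine (Finset.sum_le_sum fun j _ => hj j).trans_eq ?_
  rw [← Finset.mul_sum, Finset.sum_sub_distrib]
  simp

theorem sum_superchannel_bpsk {ℰ : ℝ} (h : 0 < ℰ) {N M : ℕ} (c : Fin M → Fin N → Bool)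
    (P : JointMeasurement N M) (j : Fin M) : ∑ k, superchannel (bpsk ℰ) c P j k = 1 := by
  simp only [superchannel, P.sum_norm_sq]
  rw [@norm_sq_eq_re_inner ℂ, inner_tensor]
  simp only [inner_bpsk h]
  simp

end Bpsk

end QuantumCoding

end

namespace QuantumCoding

-- Fano's inequality

section Fano

/-- The bound log y ≥ 1 - 1/y at y = w/(qu): any positive guess u for the likelihood ratio w/q
yields a lower bound. -/
theorem mul_log_div_ge {w q u : ℝ} (hw : 0 ≤ w) (hwq : 0 < w → 0 < q) (hq : 0 ≤ q) (hu : 0 < u) :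
    w * Real.log u + w - q * u ≤ w * Real.log (w / q) := by
  rcases hw.eq_or_lt with rfl | hw
  · have := mul_nonneg hq hu.le
    simpa using this
  · have hq := hwq hw
    have h1 := Real.one_sub_inv_le_log_of_pos (x := w / q / u) (by positivity)
    rw [Real.log_div (by positivity) hu.ne'] at h1
    have h2 : w * (w / q / u)⁻¹ = q * u := by
      field_simp
    have h3 := mul_le_mul_of_nonneg_left h1 hw.le
    rw [mul_sub, mul_sub, h2] at h3
    linarith

/-- Fano's inequality for a uniformly distributed input. -/
theorem mutualInfo_uniform_ge {M : ℕ} (hM : 0 < M) {W : Fin M → Fin M → ℝ}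
    (hW : ∀ j k, 0 ≤ W j k) (hW1 : ∀ j, ∑ k, W j k = 1) {ε : ℝ}
    (hε : ∑ j, (1 - W j j) ≤ M * ε) :
    (1 - ε) * Real.log M - Real.log 2 ≤ mutualInfo (fun _ => (M : ℝ)⁻¹) W := by
  have hM' : (0 : ℝ) < M := by exact_mod_cast hM
  have hMi : (0 : ℝ) < (M : ℝ)⁻¹ := inv_pos.2 hM'
  have hlog : 0 ≤ Real.log M := Real.log_natCast_nonneg M
  set q : Fin M → ℝ := fun k => ∑ i, (M : ℝ)⁻¹ * W i k with hq
  have hq0 : ∀ k, 0 ≤ q k := fun k => Finset.sum_nonneg fun i _ => mul_nonneg hMi.le (hW i k)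
  have hq1 : ∑ k, q k = 1 := by
    simp only [hq]
    rw [Finset.sum_comm]
    simp_rw [← Finset.mul_sum, hW1]
    simp [hM'.ne']
  have hWq : ∀ j k, 0 < W j k → 0 < q k := fun j k h =>
    (mul_pos hMi h).trans_le (Finset.single_le_sum
      (f := fun i => (M : ℝ)⁻¹ * W i k) (fun i _ => mul_nonneg hMi.le (hW i k)) (Finset.mem_univ j))
  -- Up to the factor M, this guess is the posterior that trusts the output with weight 1/2 and is
  -- uniform otherwise. It is normalised (`hqu`), and halving costs the log 2.
  let u : Fin M → Fin M → ℝ := fun j k => (if j = k then (M : ℝ) / 2 else 0) + 1 / 2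
  have hu : ∀ j k, 0 < u j k := fun j k => by
    simp only [u]
    split_ifs <;> positivity
  have hlogu : ∀ j k, (if j = k then Real.log M else 0) - Real.log 2 ≤ Real.log (u j k) := by
    intro j k
    simp only [u]
    split_ifs
    · rw [← Real.log_div hM'.ne' two_ne_zero]
      exact Real.log_le_log (by positivity) (by linarith)
    · simp
  have hterm : ∀ j k, (M : ℝ)⁻¹ * (W j k * ((if j = k then Real.log M else 0) - Real.log 2) +
      W j k - q k * u j k) ≤ (M : ℝ)⁻¹ * W j k * Real.log (W j k / q k) := by
    intro j k
    rw [mul_assoc]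
    refine mul_le_mul_of_nonneg_left ?_ hMi.le
    refine le_trans ?_ (mul_log_div_ge (hW j k) (hWq j k) (hq0 k) (hu j k))
    have := mul_le_mul_of_nonneg_left (hlogu j k) (hW j k)
    linarith
  have hqu : ∑ j, ∑ k, q k * u j k = M := by
    rw [Finset.sum_comm]
    have : ∀ k, ∑ j, q k * u j k = q k * M := by
      intro k
      rw [← Finset.mul_sum]
      simp only [u]
      rw [Finset.sum_add_distrib, Finset.sum_ite_eq']
      simp
      left
      ring
    simp_rw [this]
    rw [← Finset.sum_mul, hq1, one_mul]
  have hdiag : M * (1 - ε) ≤ ∑ j, W j j := by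
    rw [Finset.sum_sub_distrib] at hε
    simp at hε
    linarith
  refine le_trans ?_ (Finset.sum_le_sum fun j _ => Finset.sum_le_sum fun k _ => hterm j k)
  have hsum : ∑ j, ∑ k, (M : ℝ)⁻¹ * (W j k * ((if j = k then Real.log M else 0) - Real.log 2) +
      W j k - q k * u j k) = (M : ℝ)⁻¹ * ((∑ j, W j j) * Real.log M - M * Real.log 2) := by
    simp_rw [← Finset.mul_sum, Finset.sum_sub_distrib, Finset.sum_add_distrib, hqu, hW1, mul_sub,
      Finset.sum_sub_distrib, ← Finset.sum_mul, hW1]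
    simp [Finset.sum_mul]
    ring
  rw [hsum]
  have h1 := mul_le_mul_of_nonneg_left (mul_le_mul_of_nonneg_right hdiag hlog) hMi.le
  have h2 : (M : ℝ)⁻¹ * (M * (1 - ε) * Real.log M) = (1 - ε) * Real.log M := by
    field_simp
  have h3 : (M : ℝ)⁻¹ * (M * Real.log 2) = Real.log 2 := by
    field_simp
  rw [mul_sub, h3]
  linarith

end Fano

-- Lower bounds on the capacity

section Capacity

theorem mutualInfo_le_CN {X : Type} (ψ : X → Mode) {N M : ℕ} (c : Fin M → Fin N → X)
    (P : JointMeasurement N M) {p : Fin M → ℝ} (hp : p ∈ stdSimplex ℝ (Fin M)) :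
    ((mutualInfo p (superchannel ψ c P) : ℝ) : EReal) ≤ CN ψ N :=
  le_iSup_of_le M <| le_iSup_of_le c <| le_iSup_of_le P <|
    le_iSup (fun p : stdSimplex ℝ (Fin M) => ((mutualInfo p (superchannel ψ c P) : ℝ) : EReal))
      ⟨p, hp⟩

theorem CN_bpsk_nonneg {ℰ : ℝ} (h : 0 < ℰ) {N : ℕ} (hN : 0 < N) : 0 ≤ CN (bpsk ℰ) N := by
  obtain ⟨c, P, -⟩ := exists_code_measurement h hN one_pos le_rfl zero_le_one
  refine le_trans ?_ (mutualInfo_le_CN (bpsk ℰ) c P (p := fun _ => 1) ?_)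
  · have h1 := sum_superchannel_bpsk h c P 0
    simp only [Fin.sum_univ_one] at h1
    simp [mutualInfo, h1]
  · simp [stdSimplex]

/-- Coding at rate `R` with a code of the random-coding ensemble. -/
theorem CN_bpsk_ge {ℰ R s : ℝ} (h : 0 < ℰ) {N : ℕ} (hN : 0 < N) (hR : 0 ≤ R) (hs0 : 0 ≤ s)
    (hs1 : s ≤ 1) :
    (((1 - 2 * Real.exp (-N * (-Real.log (((1 + Real.exp (-2 * ℰ)) / 2) ^ (1 + s) +
      ((1 - Real.exp (-2 * ℰ)) / 2) ^ (1 + s)) - s * R))) * (N * R) - Real.log 2 : ℝ) : EReal) ≤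
      CN (bpsk ℰ) N := by
  set Z := ((1 + Real.exp (-2 * ℰ)) / 2) ^ (1 + s) + ((1 - Real.exp (-2 * ℰ)) / 2) ^ (1 + s) with hZ
  set ε := 2 * Real.exp (-N * (-Real.log Z - s * R)) with hε
  have hexp1 : Real.exp (-2 * ℰ) < 1 := by
    simpa using Real.exp_lt_exp.2 (show -2 * ℰ < 0 by linarith)
  have hZ0 : 0 < Z := by
    have : 0 < Real.exp (-2 * ℰ) := Real.exp_pos _
    exact add_pos (Real.rpow_pos_of_pos (by linarith) _) (Real.rpow_pos_of_pos (by linarith) _)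
  have hNR : 0 ≤ N * R := mul_nonneg (Nat.cast_nonneg _) hR
  -- For ε ≥ 1 the claimed bound is negative; otherwise 1 - ε > 0 lets log M be replaced by NR.
  rcases le_or_gt 1 ε with h1 | h1
  · refine le_trans ?_ (CN_bpsk_nonneg h hN)
    rw [← EReal.coe_zero, EReal.coe_le_coe_iff]
    have := mul_nonneg (sub_nonneg.2 h1) hNR
    have := Real.log_pos one_lt_two
    linarith
  -- Rounding up costs nothing: log M ≥ NR, while the error bound contains only M - 1 ≤ e^(NR).
  let M := ⌈Real.exp (N * R)⌉₊
  have hMpos : 0 < M := Nat.ceil_pos.2 (Real.exp_pos _)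
  have hM1 : (1 : ℝ) ≤ M := by exact_mod_cast hMpos
  have hMle : (M : ℝ) - 1 ≤ Real.exp (N * R) := by
    have := Nat.ceil_lt_add_one (Real.exp_pos (N * R)).le
    linarith
  have hlogM : N * R ≤ Real.log M :=
    (Real.le_log_iff_exp_le (by linarith)).2 (Nat.le_ceil _)
  obtain ⟨c, P, hP⟩ := exists_code_measurement h hN hMpos hs0 hs1
  have hle : 2 * ((M : ℝ) - 1) ^ s * Z ^ N ≤ ε := by
    have e1 : ((M : ℝ) - 1) ^ s ≤ Real.exp (N * R * s) := by
      rw [Real.exp_mul]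
      exact Real.rpow_le_rpow (by linarith) hMle hs0
    have e2 : ε = 2 * Real.exp (N * R * s) * Z ^ N := by
      rw [hε, ← Real.exp_log (pow_pos hZ0 N), Real.log_pow, mul_assoc, ← Real.exp_add]
      congr 2
      ring
    rw [e2]
    gcongr
  have hfano := mutualInfo_uniform_ge hMpos (fun j k => sq_nonneg _)
    (sum_superchannel_bpsk h c P) (hP.trans (mul_le_mul_of_nonneg_left hle (by linarith)))
  refine le_trans ?_ (mutualInfo_le_CN (bpsk ℰ) c P (p := fun _ => (M : ℝ)⁻¹) ?_)
  · rw [EReal.coe_le_coe_iff]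
    refine le_trans ?_ hfano
    have := mul_le_mul_of_nonneg_left hlogM (sub_nonneg.2 h1.le)
    linarith
  · refine ⟨fun _ => by positivity, ?_⟩
    have : (M : ℝ) ≠ 0 := by linarith
    simp [this]

end Capacity

-- Admissibility for small energy

section Asymptotics

/-- Here s(R*) ≤ 1 amounts to ℰ ≤ 1 - √δ. Since log log a ≤ log a ≤ a/e, δ ≤ 2/e < 0.86², so 1 - √δ
≥ 0.14 > e⁻³ > ℰ. The threshold e⁻³ also gives a ≥ L > 3 > e, hence log a > 1. -/
theorem admissible_of_lt_exp_neg_three {ℰ : ℝ} {N : ℕ} (h : 0 < ℰ) (h3 : ℰ < Real.exp (-3))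
    (hN : ℰ⁻¹ * Real.log (1 / ℰ) ≤ N) : Admissible ℰ N := by
  set L := Real.log (1 / ℰ) with hL
  have hLE : L = -Real.log ℰ := by rw [hL, one_div, Real.log_inv]
  have hL3 : 3 < L := by
    have := Real.log_lt_log h h3
    rw [Real.log_exp] at this
    linarith
  set a := N * ℰ with ha
  have haL : L ≤ a := by
    have := mul_le_mul_of_nonneg_right hN h.le
    rwa [mul_right_comm, inv_mul_cancel₀ h.ne', one_mul] at this
  have ha0 : 0 < a := by linarith
  have hloga : 1 < Real.log a := by
    rw [Real.lt_log_iff_exp_lt ha0]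
    linarith [Real.exp_one_lt_d9]
  have hb : 1 ≤ a * Real.log a := by nlinarith
  set δ := Real.log (a * Real.log a) / a with hδ
  have hδ0 : 0 ≤ δ := div_nonneg (Real.log_nonneg hb) ha0.le
  have hδ1 : δ ≤ (0.86 : ℝ) ^ 2 := by
    have h1 : Real.log (Real.log a) ≤ Real.log a :=
      Real.log_le_log (by linarith) ((Real.log_le_sub_one_of_pos ha0).trans (by linarith))
    have h2 : Real.log a ≤ a / Real.exp 1 := by
      have := Real.log_le_sub_one_of_pos (div_pos ha0 (Real.exp_pos 1))
      rw [Real.log_div ha0.ne' (Real.exp_pos 1).ne', Real.log_exp] at this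
      linarith
    have h4 : a / Real.exp 1 ≤ a / 2.71 := by
      gcongr
      linarith [Real.exp_one_gt_d9]
    rw [hδ, div_le_iff₀ ha0, Real.log_mul ha0.ne' (by linarith)]
    have h5 : a / 2.71 * 2 ≤ 0.86 ^ 2 * a := by
      rw [div_mul_eq_mul_div, div_le_iff₀ (by norm_num)]
      nlinarith
    linarith
  have hsq : Real.sqrt δ ≤ 0.86 := Real.sqrt_le_iff.2 ⟨by norm_num, hδ1⟩
  have hsq0 := Real.sqrt_nonneg δ
  have hR : Rstar ℰ N - ℰ = ℰ * L * (1 - Real.sqrt δ) := by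
    simp only [Rstar, ← ha, ← hL, ← hδ]
    ring
  have hpos : 0 < ℰ * L * (1 - Real.sqrt δ) :=
    mul_pos (mul_pos h (by linarith)) (by linarith)
  have hs : sParam ℰ (Rstar ℰ N) = -Real.log (1 - Real.sqrt δ) / L := by
    rw [sParam, hR, Real.log_mul (mul_pos h (by linarith)).ne' (by linarith),
      Real.log_mul h.ne' (by linarith), ← hL]
    have : L ≠ 0 := by linarith
    field_simp
    linarith
  refine ⟨hb, by linarith, ?_, ?_⟩
  · rw [hs]
    refine div_nonneg (neg_nonneg.2 (Real.log_nonpos ?_ ?_)) (by linarith) <;> linarith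
  · rw [hs, div_le_one (by linarith), hLE, neg_le_neg_iff]
    refine Real.log_le_log h ?_
    have : Real.exp (-3) < 0.14 := by
      rw [Real.exp_neg, inv_lt_comm₀ (Real.exp_pos _) (by norm_num)]
      have : (3 : ℝ) = 1 + 1 + 1 := by norm_num
      rw [this, Real.exp_add, Real.exp_add]
      have := Real.exp_one_gt_d9
      have : (2 : ℝ) < Real.exp 1 := by linarith
      have : 4 < Real.exp 1 * Real.exp 1 := by nlinarith
      nlinarith
    linarith

end Asymptotics

end QuantumCoding

theorem corollary1 :
    (∀ (ℰ : ℝ) (N : ℕ), 0 < ℰ → ℰ < 1 → ℰ⁻¹ * Real.log (1 / ℰ) ≤ N →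
      QuantumCoding.Admissible ℰ N →
      (((1 - 2 * Real.exp (-N * QuantumCoding.Etilde ℰ (QuantumCoding.Rstar ℰ N))) *
            QuantumCoding.Rstar ℰ N - Real.log 2 / N : ℝ) : EReal)
        ≤ QuantumCoding.CN (QuantumCoding.bpsk ℰ) N / (N : EReal)) ∧
    (∃ ℰ₀ : ℝ, 0 < ℰ₀ ∧ ℰ₀ ≤ 1 ∧ ∀ (ℰ : ℝ) (N : ℕ), 0 < ℰ → ℰ < ℰ₀ →
      ℰ⁻¹ * Real.log (1 / ℰ) ≤ N → QuantumCoding.Admissible ℰ N) := by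
  refine ⟨fun ℰ N h h1 hN hA => ?_, Real.exp (-3), Real.exp_pos _,
    Real.exp_le_one_iff.2 (by norm_num), fun ℰ N h h3 hN =>
      QuantumCoding.admissible_of_lt_exp_neg_three h h3 hN⟩
  have hN0 : (0 : ℝ) < N :=
    (mul_pos (inv_pos.2 h) (Real.log_pos ((one_lt_div h).2 h1))).trans_le hN
  obtain ⟨-, hR, hs0, hs1⟩ := hA
  rw [EReal.le_div_iff_mul_le (by exact_mod_cast hN0) (EReal.natCast_ne_top N),
    ← EReal.coe_coe_eq_natCast, ← EReal.coe_mul]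
  refine le_trans (le_of_eq ?_) (QuantumCoding.CN_bpsk_ge h (Nat.cast_pos.1 hN0)
    (h.trans hR).le hs0 hs1)
  congr 1
  rw [QuantumCoding.Etilde]
  field_simp
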